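/- **Theorem (robust completeness).** Let $|\cdot|$ be the infinity norm on $\mathbb{R}^n$, $n\ge 1$, let $\mathcal{W}\subset\mathbb{R}^n$ be a bounded open working space with complement $\mathcal{W}^c$ (the out-of-domain states) and boundary $\partial\mathcal{W}$, and let $\mathcal{U}\subset\mathbb{R}^p$ be compact. Let $f:\mathbb{R}^n\times\mathbb{R}^p\to\mathbb{R}^n$ and $b:\mathbb{R}^n\to\mathbb{R}^{n\times k}$ be locally Lipschitz, let $AP$ be a finite set and $L:\mathbb{R}^n\to 2^{AP}$ a measurable labelling function. Let $0\le\vartheta_1<\vartheta_2$ and consider $$X_{t+1}=f(X_t,u_t)+b(X_t)w_t+\vartheta_i\,\xi^{(i)}_t,\qquad i=1,2,$$ with $w_t\sim\mathcal{N}(0,I_k)$, $|\xi^{(1)}_t|\le 1$ almost surely and $\mathbf{E}|\xi^{(2)}_t|\le 1$; apart from this the joint law of $(w_t,\xi^{(i)}_t)$ is unknown. For $u\in\mathcal{U}$ let $[\![\mathcal{T}^u]\!]_i$ be the set of transition probabilities $\mathcal{T}^u(x,\cdot)=\mathrm{Law}\big(f(x,u)+b(x)w+\vartheta_i\xi\big)$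 obtained from all joint laws of $(w,\xi)$ permitted for system $i$. A boundary modification of $\mathcal{T}$ is a transition probability $\widetilde{\mathcal{T}}$ with * $\widetilde{\mathcal{T}}(x,\Gamma)=\mathcal{T}(x,\Gamma)$ for measurable $\Gamma\subseteq\mathcal{W}$ and $\widetilde{\mathcal{T}}(x,\partial\mathcal{W})=\mathcal{T}(x,\mathcal{W}^c)$, for $x\in\mathcal{W}$; * $\widetilde{\mathcal{T}}(x,\partial\mathcal{W})=1$ for $x\in\partial\mathcal{W}$; * $\widetilde{\mathcal{T}}(x,\mathcal{W})=0$ for $x\notin\mathcal{W}$. Let $\mathbb{XU}_i$ be the controlled Markov system with state space $\mathbb{R}^n$, inputs $\mathcal{U}$, labels $L$ and, for each $u$, the collection $[\![\widetilde{\mathcal{T}}^u]\!]_i$ of all boundary modifications of members of $[\![\mathcal{T}^u]\!]_i$. A rectangle is a product of $n$ intervals, with or without their end points. A rectangular partition of $\mathcal{W}$ is a finite partition of $\mathcal{W}$ into nonempty rectangles. Assume that $L$ is amenable to a rectangular partition: there is a rectangular partition $\{P_1,\dots,P_J\}$ of $\mathcal{W}$ such that $L$ is constant on each $P_i$ and on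 $\mathcal{W}^c$. Then there exist * a mesh size $\eta>0$ and a rectangular partition $\{C_1,\dots,C_N\}$ of $\mathcal{W}$ cut out of $P_1,\dots,P_J$ by the uniform grid of mesh $\eta$, i.e. each $C_j$ is of the form $P_i\cap\{x:\lfloor x/\eta\rfloor=z\}$ with $z\in\mathbb{Z}^n$; with the nodes $\mathcal{Q}=\{q_1,\dots,q_N,q_{N+1}=\Delta\}$ it defines the state-level relation $\alpha\subseteq\mathbb{R}^n\times\mathcal{Q}$ with $\alpha^{-1}(q_j)=C_j$ for $j\le N$ and $\alpha^{-1}(\Delta)=\mathcal{W}^c$; * a measure-level relation $\Sigma_\alpha\subseteq\mathfrak{P}(\mathbb{R}^n)\times\mathfrak{P}(\mathcal{Q})$; * a finite-state abstraction system $\mathbb{IA}=(\mathcal{Q},Act,\{\Theta\},AP,L_{\mathbb{IA}})$ with finite $Act$, whose collections of stochastic matrices are generated by finitely many BMDPs: there are finitely many pairs of families of bounds $\check\Theta^{a,l},\hat\Theta^{a,l}$ with $[\![\Theta^a]\!]=\bigcup_l\{\Theta\text{ stochastic}:\check\Theta^{a,l}\le\Theta\le\hat\Theta^{a,l}\text{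 entrywise}\}$ for all $a\in Act$, such that $\mathbb{XU}_1\preceq_{\Sigma_\alpha}\mathbb{IA}$ and $\mathbb{IA}\preceq_{\Sigma_\alpha^{-1}}\mathbb{XU}_2$, that is: 1. For every $x\in\mathbb{R}^n$ there is $q\in\mathcal{Q}$ with $(x,q)\in\alpha$ and $L_{\mathbb{IA}}(q)=L(x)$. For all $q_i\in\mathcal{Q}$ and $a\in Act$ there is $u\in\mathcal{U}$ such that for every $\widetilde{\mathcal{T}}^u\in[\![\widetilde{\mathcal{T}}^u]\!]_1$ and every $x\in\alpha^{-1}(q_i)$ there is $\Theta^a\in[\![\Theta^a]\!]$ with $(\widetilde{\mathcal{T}}^u(x,\cdot),\Theta^a_i)\in\Sigma_\alpha$ and $\widetilde{\mathcal{T}}^u(x,\alpha^{-1}(q_j))=\Theta^a_{ij}$ for all $j$. 2. For every $q\in\mathcal{Q}$ there is $x\in\mathbb{R}^n$ with $(x,q)\in\alpha$ and $L(x)=L_{\mathbb{IA}}(q)$. For all $q_i\in\mathcal{Q}$ and $u\in\mathcal{U}$ there is $a\in Act$ such that for every $\Theta^a\in[\![\Theta^a]\!]$ and every $x\in\alpha^{-1}(q_i)$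 there is $\widetilde{\mathcal{T}}^u\in[\![\widetilde{\mathcal{T}}^u]\!]_2$ with $(\Theta^a_i,\widetilde{\mathcal{T}}^u(x,\cdot))\in\Sigma_\alpha^{-1}$ and $\Theta^a_{ij}=\widetilde{\mathcal{T}}^u(x,\alpha^{-1}(q_j))$ for all $j$. -/

import Mathlib

open MeasureTheory ProbabilityTheory
open scoped Matrix

/-- `ℝⁿ`; the norm of this type is the infinity norm. -/
abbrev Vec (n : ℕ) : Type := Fin n → ℝ

/-! ### Transition probabilities -/

/-- Transition probabilities (Markov kernels) on a state space. -/
abbrev MarkovKernel (X : Type*) [MeasurableSpace X] : Type _ :=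
  {T : Kernel X X // IsMarkovKernel T}

/-- The probability measure `T(x, ·)`. -/
def MarkovKernel.law {X : Type*} [MeasurableSpace X] (T : MarkovKernel X) (x : X) :
    ProbabilityMeasure X :=
  ⟨T.1 x, T.2.isProbabilityMeasure x⟩

/-- Stochastic matrices indexed by a finite set of nodes. -/
abbrev StochasticMatrix (Q : Type*) [Fintype Q] [DecidableEq Q] : Type _ :=
  {M : Matrix Q Q ℝ // M ∈ Matrix.rowStochastic ℝ Q}

/-- The `i`-th row of a stochastic matrix, as a probability measure on the nodes. -/
noncomputable def StochasticMatrix.rowLaw {Q : Type*} [Fintype Q] [DecidableEq Q]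
    [MeasurableSpace Q] (M : StochasticMatrix Q) (i : Q) : ProbabilityMeasure Q :=
  ⟨∑ j, ENNReal.ofReal (M.1 i j) • Measure.dirac j, ⟨by
    simp only [Measure.coe_finsetSum, Finset.sum_apply, Measure.smul_apply, measure_univ,
      smul_eq_mul, mul_one]
    rw [← ENNReal.ofReal_sum_of_nonneg (fun j _ => M.2.1 i j),
      Matrix.sum_row_of_mem_rowStochastic M.2 i, ENNReal.ofReal_one]⟩⟩

/-! ### Controlled Markov systems and BMDPs -/

/-- A controlled Markov system with states `X`, control inputs `U` and atomic propositions `AP`: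
for every input a collection of transition probabilities, and a measurable labelling function. -/
structure ControlledMarkovSystem (X U AP : Type*) [MeasurableSpace X] where
  trans : U → Set (MarkovKernel X)
  label : X → Set AP
  measurable_label : ∀ A : Set AP, MeasurableSet (label ⁻¹' {A})

/-- A finite-state controlled Markov system with nodes `Q` and actions `Act`: for every action a
collection of stochastic matrices, and a labelling function. -/
structure FiniteMarkovSystem (Q Act AP : Type*) [Fintype Q] [DecidableEq Q] where
  trans : Act → Set (StochasticMatrix Q)
  label : Q → Set AP

/-- A bounded-parameter Markov decision process: for every action, entrywise lower and upper
bounds on the transition matrices. -/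
structure BMDP (Q Act AP : Type*) where
  lower : Act → Matrix Q Q ℝ
  upper : Act → Matrix Q Q ℝ
  label : Q → Set AP

/-- The stochastic matrices lying entrywise between the bounds of a BMDP. -/
def BMDP.trans {Q Act AP : Type*} [Fintype Q] [DecidableEq Q] (B : BMDP Q Act AP) (a : Act) :
    Set (StochasticMatrix Q) :=
  {M | ∀ i j, B.lower a i j ≤ M.1 i j ∧ M.1 i j ≤ B.upper a i j}

/-- The collections of transition matrices of the finite-state system are the unions of those of
finitely many BMDPs on the same nodes, with the same actions and labels. -/
def FiniteMarkovSystem.IsGeneratedByBMDPs {Q Act AP : Type*} [Fintype Q] [DecidableEq Q]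
    (I : FiniteMarkovSystem Q Act AP) : Prop :=
  ∃ (K : ℕ) (B : Fin K → BMDP Q Act AP),
    (∀ l, (B l).label = I.label) ∧ ∀ a, I.trans a = ⋃ l, (B l).trans a

/-! ### Abstraction relations -/

/-- The finite-state system `I` abstracts the system `S` via the state-level relation `α` and the
measure-level relation `R`. Here `α.preimage {q}` is `α⁻¹(q)`. -/
def Abstracts {X U Q Act AP : Type*} [MeasurableSpace X] [Fintype Q] [DecidableEq Q]
    [MeasurableSpace Q] (S : ControlledMarkovSystem X U AP) (I : FiniteMarkovSystem Q Act AP)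
    (α : SetRel X Q) (R : SetRel (ProbabilityMeasure X) (ProbabilityMeasure Q)) : Prop :=
  (∀ x, ∃ q, (x, q) ∈ α ∧ I.label q = S.label x) ∧
  ∀ (i : Q) (a : Act), ∃ u : U, ∀ T ∈ S.trans u, ∀ x ∈ α.preimage {i}, ∃ M ∈ I.trans a,
    (T.law x, M.rowLaw i) ∈ R ∧ ∀ j, (T.1 x).real (α.preimage {j}) = M.1 i j

/-- The converse notion: the system `S` abstracts the finite-state system `I` via a state-level
relation `β` and a measure-level relation `R`, both going from `I` to `S`. Here `β.image {q}` is
the set of states that `β` relates to the node `q`. -/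
def ConverseAbstracts {X U Q Act AP : Type*} [MeasurableSpace X] [Fintype Q] [DecidableEq Q]
    [MeasurableSpace Q] (I : FiniteMarkovSystem Q Act AP) (S : ControlledMarkovSystem X U AP)
    (β : SetRel Q X) (R : SetRel (ProbabilityMeasure Q) (ProbabilityMeasure X)) : Prop :=
  (∀ q, ∃ x, (q, x) ∈ β ∧ S.label x = I.label q) ∧
  ∀ (i : Q) (u : U), ∃ a : Act, ∀ M ∈ I.trans a, ∀ x ∈ β.image {i}, ∃ T ∈ S.trans u,
    (M.rowLaw i, T.law x) ∈ R ∧ ∀ j, M.1 i j = (T.1 x).real (β.image {j})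

/-! ### Rectangular partitions -/

/-- A rectangle: a product of intervals, with or without their end points. -/
def IsRectangle {n : ℕ} (C : Set (Vec n)) : Prop :=
  ∃ J : Fin n → Set ℝ, (∀ d, (J d).OrdConnected) ∧ C = {x | ∀ d, x d ∈ J d}

/-- The cells `C i` are nonempty rectangles and partition `W`. -/
def IsRectPartition {n : ℕ} {ι : Type*} (W : Set (Vec n)) (C : ι → Set (Vec n)) : Prop :=
  (∀ i, IsRectangle (C i) ∧ (C i).Nonempty) ∧ Pairwise (fun i j => Disjoint (C i) (C j)) ∧
    ⋃ i, C i = W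

/-- The labelling function is constant on every cell of a partition of `W`, and constant outside
of `W`. -/
def LabelConstantOn {n : ℕ} {ι AP : Type*} (L : Vec n → Set AP) (W : Set (Vec n))
    (C : ι → Set (Vec n)) : Prop :=
  (∀ i, ∀ x ∈ C i, ∀ y ∈ C i, L x = L y) ∧ ∀ x ∈ Wᶜ, ∀ y ∈ Wᶜ, L x = L y

/-- The cell `{x : ⌊x / η⌋ = z}` of the uniform cubic grid with mesh size `η`. -/
def gridCell {n : ℕ} (η : ℝ) (z : Fin n → ℤ) : Set (Vec n) :=
  {x | ∀ d, ⌊x d / η⌋ = z d}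

/-- The cells `C` are cut out of the cells `P` by the uniform grid of mesh size `η`. -/
def IsUniformRefinement {n : ℕ} {ι ι' : Type*} (P : ι → Set (Vec n)) (η : ℝ)
    (C : ι' → Set (Vec n)) : Prop :=
  ∀ j, ∃ i z, C j = P i ∩ gridCell η z

/-- The state-level relation of a partition of `W` into `N` cells. The nodes are the cells and a
last node `Δ`, which stands for the complement of `W`. -/
def partitionRel {n N : ℕ} (W : Set (Vec n)) (C : Fin N → Set (Vec n)) :
    SetRel (Vec n) (Fin (N + 1)) :=
  {s | (∃ j : Fin N, s.2 = j.castSucc ∧ s.1 ∈ C j) ∨ (s.2 = Fin.last N ∧ s.1 ∈ Wᶜ)}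

/-! ### The stochastic control systems -/

/-- The standard Gaussian law `N(0, I)` on `ℝᵏ`. -/
noncomputable def stdGaussianLaw (k : ℕ) : Measure (Vec k) :=
  Measure.pi fun _ => gaussianReal 0 1

/-- The possible joint laws of `(w, ξ)`, with `w` standard Gaussian and `ξ` in the closed unit ball
of `ℝⁿ`. -/
def boundedNoiseLaws (k n : ℕ) : Set (Measure (Vec k × Vec n)) :=
  {ρ | ρ.map Prod.fst = stdGaussianLaw k ∧ ∀ᵐ z ∂ρ, ‖z.2‖ ≤ 1}

/-- The possible joint laws of `(w, ξ)`, with `w` standard Gaussian and `E|ξ| ≤ 1`. -/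
def integrableNoiseLaws (k n : ℕ) : Set (Measure (Vec k × Vec n)) :=
  {ρ | ρ.map Prod.fst = stdGaussianLaw k ∧ ∫⁻ z, ‖z.2‖ₑ ∂ρ ≤ 1}

/-- The transition probabilities `T(x, ·)` = law of `f(x, u) + b(x) w + ϑ ξ`, the joint law of
`(w, ξ)` being taken from the class `noise`. -/
def perturbedTrans {n p k : ℕ} (f : Vec n → Vec p → Vec n)
    (b : Vec n → Matrix (Fin n) (Fin k) ℝ) (θ : ℝ) (noise : Set (Measure (Vec k × Vec n)))
    (u : Vec p) : Set (MarkovKernel (Vec n)) :=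
  {T | ∃ ρ ∈ noise, ∀ x, T.1 x = ρ.map fun z => f x u + b x *ᵥ z.1 + θ • z.2}

/-- `T'` is a boundary modification of `T` on the working space `W`: it agrees with `T` inside of
`W`, moves the mass that leaves `W` to the boundary of `W`, is absorbed by the boundary, and never
returns to `W`. -/
def IsBoundaryModification {n : ℕ} (W : Set (Vec n)) (T T' : MarkovKernel (Vec n)) : Prop :=
  (∀ x ∈ W, (∀ Γ, MeasurableSet Γ → Γ ⊆ W → T'.1 x Γ = T.1 x Γ) ∧
    T'.1 x (frontier W) = T.1 x Wᶜ) ∧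
  (∀ x ∈ frontier W, T'.1 x (frontier W) = 1) ∧
  ∀ x ∈ Wᶜ, T'.1 x W = 0

/-- The boundary-modified controlled Markov system driven by
`X_{t+1} = f(X_t, u_t) + b(X_t) w_t + ϑ ξ_t`. -/
def modifiedSystem {n p k : ℕ} {AP : Type*} (W : Set (Vec n)) (U : Set (Vec p))
    (f : Vec n → Vec p → Vec n) (b : Vec n → Matrix (Fin n) (Fin k) ℝ) (θ : ℝ)
    (noise : Set (Measure (Vec k × Vec n))) (L : Vec n → Set AP)
    (hL : ∀ A : Set AP, MeasurableSet (L ⁻¹' {A})) : ControlledMarkovSystem (Vec n) U AP where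
  trans u := {T' | ∃ T ∈ perturbedTrans f b θ noise u, IsBoundaryModification W T T'}
  label := L
  measurable_label := hL

/-! The gap `θ₂ - θ₁` pays for discretisation. For each input of a finite net and each cell, the
transition rows of the first system form a subset of a simplex. A finite net of this set, with a
small box around each net point, yields finitely many BMDPs that contain all these rows and whose
rows all lie near one of them (`exists_finiteMarkovSystem_near`). The first abstraction is then
immediate.

For the converse, a row of the finite system is close to the node law of `Y = F₁ + B₁ w + θ₁ ξ` for
some state and input near the given ones. A coupling (`exists_coupling_of_nodes`) reassigns the node
of `Y` with small probability so that the prescribed row becomes exact; on a reassignment `Y` jumps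
to a representative of the new node. The new point is written as `F₂ + B₂ w + θ₂ ξ'` with the same
`w`, which determines `ξ'`. This is legitimate because any dependence between `w` and `ξ'` is
permitted; only `E|ξ'| ≤ 1` must be checked (`exists_integrableNoise_of_near`). The jumps are rare
but not small, so `ξ'` need not obey the almost sure bound; this is where the weaker moment
condition on the second system enters.

Outside `W` the noise has no influence on the nodes, so the row of `Δ` is treated exactly. -/

/-! ### Transport and coupling of finite distributions -/

/-- Keep the common mass `min (μ j) (m j)` in place and spread the excess of `μ` over the deficits
in proportion to their size. Only the excess moves. -/
theorem exists_transport_of_mem_stdSimplex {Q : Type*} [Fintype Q] [DecidableEq Q] {μ m : Q → ℝ}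
    (hμ : μ ∈ stdSimplex ℝ Q) (hm : m ∈ stdSimplex ℝ Q) :
    ∃ κ : Q → Q → ℝ, (∀ j l, 0 ≤ κ j l) ∧ (∀ j, ∑ l, κ j l = 1) ∧
      (∀ l, ∑ j, μ j * κ j l = m l) ∧ ∑ j, μ j * (1 - κ j j) ≤ ∑ j, |μ j - m j| := by
  set e : Q → ℝ := fun j => max (μ j - m j) 0 with he
  set d : Q → ℝ := fun j => max (m j - μ j) 0 with hd
  have he0 : ∀ j, 0 ≤ e j := fun j => le_max_right _ _
  have hd0 : ∀ j, 0 ≤ d j := fun j => le_max_right _ _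
  have hed : ∀ j, e j - d j = μ j - m j := fun j => by
    simp only [he, hd]; rcases le_total (μ j) (m j) with h | h
    · rw [max_eq_right (by linarith), max_eq_left (by linarith)]; ring
    · rw [max_eq_left (by linarith), max_eq_right (by linarith)]; ring
  have hDD : ∑ j, e j = ∑ j, d j := by
    have : ∑ j, (e j - d j) = 0 := by
      simp only [hed, Finset.sum_sub_distrib, hμ.2, hm.2, sub_self]
    rw [Finset.sum_sub_distrib] at this; linarith
  have hmin : ∀ j, min (μ j) (m j) + e j = μ j ∧ min (μ j) (m j) + d j = m j := fun j => by
    simp only [he, hd]; rcases le_total (μ j) (m j) with h | h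
    · rw [max_eq_right (by linarith), max_eq_left (by linarith), min_eq_left h]
      constructor <;> ring
    · rw [max_eq_left (by linarith), max_eq_right (by linarith), min_eq_right h]
      constructor <;> ring
  by_cases hD : ∑ j, e j = 0
  · have h1 := (Finset.sum_eq_zero_iff_of_nonneg fun j _ => he0 j).1 hD
    have h2 := (Finset.sum_eq_zero_iff_of_nonneg fun j _ => hd0 j).1 (hDD ▸ hD)
    refine ⟨fun j l => if j = l then 1 else 0, fun j l => by positivity, by simp, fun l => ?_, ?_⟩
    · have := hed l
      rw [h1 l (Finset.mem_univ _), h2 l (Finset.mem_univ _)] at this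
      simp; linarith
    · simpa using Finset.sum_nonneg fun j _ => abs_nonneg (μ j - m j)
  · set D := ∑ j, e j with hDdef
    have hDpos : 0 < D := lt_of_le_of_ne (Finset.sum_nonneg fun j _ => he0 j) (Ne.symm hD)
    have key : ∀ j, μ j = 0 → e j = 0 ∧ min (μ j) (m j) = 0 := fun j h => by
      simp [he, h, hm.1 j]
    -- Where `μ j = 0` the row is arbitrary; the identity row keeps its sum equal to 1.
    set κ : Q → Q → ℝ := fun j l => if μ j = 0 then (if j = l then 1 else 0) else
      ((if j = l then min (μ j) (m j) else 0) + e j * d l / D) / μ j with hκ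
    have hμκ : ∀ j l, μ j * κ j l = (if j = l then min (μ j) (m j) else 0) + e j * d l / D := by
      intro j l
      by_cases h : μ j = 0
      · rw [(key j h).1, (key j h).2, h]; simp
      · simp only [hκ, if_neg h]; field_simp
    have hmn : ∀ j, 0 ≤ min (μ j) (m j) := fun j => le_min (hμ.1 j) (hm.1 j)
    have hsum : ∀ x : ℝ, ∑ l, x * d l / D = x := fun x => by
      rw [← Finset.sum_div, ← Finset.mul_sum, ← hDD]; field_simp
    refine ⟨κ, fun j l => ?_, fun j => ?_, fun l => ?_, Finset.sum_le_sum fun j _ => ?_⟩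
    · simp only [hκ]
      have := hμ.1 j; have := he0 j; have := hd0 l; have := hmn j
      split_ifs <;> positivity
    · by_cases h : μ j = 0
      · simp [hκ, h]
      · have : μ j * ∑ l, κ j l = μ j := by
          rw [Finset.mul_sum]
          simp only [hμκ, Finset.sum_add_distrib, hsum]
          simpa using (hmin j).1
        exact mul_left_cancel₀ h (by rw [this, mul_one])
    · simp only [hμκ, Finset.sum_add_distrib]
      rw [← Finset.sum_div, ← Finset.sum_mul, ← hDdef, mul_comm, mul_div_assoc, div_self hD]
      simpa using (hmin l).2
    · rw [mul_sub, hμκ, mul_one, if_pos rfl]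
      have h1 := (hmin j).1
      have h2 : 0 ≤ e j * d j / D := by have := he0 j; have := hd0 j; positivity
      have h3 : e j ≤ |μ j - m j| := max_le (le_abs_self _) (abs_nonneg _)
      linarith

/-- Reassigning the nodes of a random point at random so that the new node has a prescribed law and
rarely differs from the old one. -/
theorem exists_coupling_of_nodes {Z Q : Type*} [MeasurableSpace Z] [Fintype Q] [DecidableEq Q]
    [MeasurableSpace Q] [MeasurableSingletonClass Q] (ρ : Measure Z) [IsProbabilityMeasure ρ]
    {c : Z → Q} (hc : Measurable c) {m : Q → ℝ} (hm : m ∈ stdSimplex ℝ Q) :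
    ∃ π : Measure (Z × Q), π.map Prod.fst = ρ ∧
      (∀ l, π (Prod.snd ⁻¹' {l}) = ENNReal.ofReal (m l)) ∧
      π {z | c z.1 ≠ z.2} ≤ ENNReal.ofReal (∑ q, |ρ.real (c ⁻¹' {q}) - m q|) := by
  have hcq : ∀ q, MeasurableSet (c ⁻¹' {q}) := fun q => hc (measurableSet_singleton q)
  have hdisj : Pairwise (Function.onFun Disjoint fun q => c ⁻¹' {q}) := fun i j hij =>
    Disjoint.preimage _ (by simpa using hij)
  have hun : ⋃ q, c ⁻¹' {q} = Set.univ := by ext z; simp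
  have hμ : (fun q => ρ.real (c ⁻¹' {q})) ∈ stdSimplex ℝ Q := by
    refine ⟨fun q => measureReal_nonneg, ?_⟩
    rw [← measureReal_iUnion_fintype hdisj hcq, hun, probReal_univ]
  obtain ⟨κ, h0, h1, h2, h3⟩ := exists_transport_of_mem_stdSimplex hμ hm
  have hpair : ∀ l : Q, Measurable fun z : Z => (z, l) := fun l => by fun_prop
  -- Given that the old node is `j`, the new node is drawn from the row `κ j`.
  set π : Measure (Z × Q) := ∑ j, ∑ l, ENNReal.ofReal (κ j l) •
    (ρ.restrict (c ⁻¹' {j})).map fun z => (z, l) with hπ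
  have happ : ∀ s, MeasurableSet s → π s = ∑ j, ∑ l, ENNReal.ofReal (κ j l) *
      ρ ((fun z => (z, l)) ⁻¹' s ∩ c ⁻¹' {j}) := fun s hs => by
    simp only [hπ, Measure.coe_finsetSum, Finset.sum_apply, Measure.smul_apply, smul_eq_mul]
    refine Finset.sum_congr rfl fun j _ => Finset.sum_congr rfl fun l _ => ?_
    rw [Measure.map_apply (hpair l) hs, Measure.restrict_apply (hpair l hs)]
  refine ⟨π, ?_, fun l => ?_, ?_⟩
  · ext s hs
    rw [Measure.map_apply measurable_fst hs, happ _ (measurable_fst hs)]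
    have : ∀ l : Q, (fun z => (z, l)) ⁻¹' (Prod.fst ⁻¹' s) = s := fun l => rfl
    simp only [this, ← Finset.sum_mul]
    simp only [← ENNReal.ofReal_sum_of_nonneg fun l _ => h0 _ l, h1, ENNReal.ofReal_one, one_mul]
    rw [← measure_biUnion_finset (f := fun q => s ∩ c ⁻¹' {q})
      (fun i _ j _ hij => (hdisj hij).mono Set.inter_subset_right Set.inter_subset_right)
      fun q _ => hs.inter (hcq q)]
    congr 1; ext z; simp
  · rw [happ _ (measurable_snd (measurableSet_singleton l))]
    have : ∀ j l' : Q, ENNReal.ofReal (κ j l') *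
        ρ ((fun z => (z, l')) ⁻¹' (Prod.snd ⁻¹' {l}) ∩ c ⁻¹' {j}) =
        if l' = l then ENNReal.ofReal (ρ.real (c ⁻¹' {j}) * κ j l') else 0 := fun j l' => by
      split_ifs with h
      · rw [ENNReal.ofReal_mul measureReal_nonneg, ofReal_measureReal, mul_comm]
        congr 2; ext z; simp [h]
      · have : (fun z : Z => (z, l')) ⁻¹' (Prod.snd ⁻¹' {l}) = ∅ := by ext z; simp [h]
        simp [this]
    simp only [this, Finset.sum_ite_eq', Finset.mem_univ, if_true]
    rw [← ENNReal.ofReal_sum_of_nonneg fun j _ => mul_nonneg measureReal_nonneg (h0 _ _), h2]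
  · have hbad : MeasurableSet {z : Z × Q | c z.1 ≠ z.2} :=
      (measurableSet_eq_fun (hc.comp measurable_fst) measurable_snd).compl
    rw [happ _ hbad]
    have : ∀ j l : Q, ENNReal.ofReal (κ j l) *
        ρ ((fun z => (z, l)) ⁻¹' {z : Z × Q | c z.1 ≠ z.2} ∩ c ⁻¹' {j}) =
        ENNReal.ofReal (ρ.real (c ⁻¹' {j}) * (κ j l - if l = j then κ j l else 0)) := fun j l => by
      split_ifs with h
      · have : (fun z => (z, l)) ⁻¹' {z : Z × Q | c z.1 ≠ z.2} ∩ c ⁻¹' {j} = ∅ := by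
          ext z; simp [h]
        rw [this]; simp
      · rw [sub_zero, ENNReal.ofReal_mul measureReal_nonneg, ofReal_measureReal, mul_comm]
        congr 2; ext z
        simp only [Set.mem_inter_iff, Set.mem_preimage, Set.mem_ofPred_eq, Set.mem_singleton_iff,
          and_iff_right_iff_imp]
        rintro rfl; exact fun h' => h h'.symm
    simp only [this]
    have hnn : ∀ j l, 0 ≤ ρ.real (c ⁻¹' {j}) * (κ j l - if l = j then κ j l else 0) := fun j l =>
      mul_nonneg measureReal_nonneg (by split_ifs <;> simp [h0])
    simp only [← ENNReal.ofReal_sum_of_nonneg fun l _ => hnn _ l]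
    rw [← ENNReal.ofReal_sum_of_nonneg fun j _ => Finset.sum_nonneg fun l _ => hnn j l]
    refine ENNReal.ofReal_le_ofReal (le_trans (le_of_eq ?_) h3)
    refine Finset.sum_congr rfl fun j _ => ?_
    rw [← Finset.mul_sum, Finset.sum_sub_distrib, h1]; simp

/-! ### Realising a perturbed node law by admissible noise -/

/-- The quadratic weight dominates the linear growth of `B w`, even with a small coefficient once a
constant is split off. -/
theorem integrable_one_add_norm_sq_stdGaussianLaw (k : ℕ) :
    Integrable (fun w : Vec k => 1 + ‖w‖ ^ 2) (stdGaussianLaw k) := by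
  have : IsProbabilityMeasure (stdGaussianLaw k) := by unfold stdGaussianLaw; infer_instance
  refine (integrable_const 1).add ?_
  have h : Integrable (fun w : Vec k => ∑ i, w i ^ 2) (stdGaussianLaw k) := by
    refine integrable_finsetSum _ fun i _ => ?_
    have h1 : Integrable (fun x : ℝ => x ^ 2) (gaussianReal 0 1) :=
      (memLp_id_gaussianReal (μ := 0) (v := 1) 2).integrable_sq
    exact (measurePreserving_eval (fun _ : Fin k => gaussianReal 0 1) i).integrable_comp_of_integrable h1
  refine h.mono' (by fun_prop) (ae_of_all _ fun w => ?_)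
  rw [Real.norm_of_nonneg (by positivity)]
  have h0 : 0 ≤ ∑ i, w i ^ 2 := Finset.sum_nonneg fun i _ => sq_nonneg _
  have : ‖w‖ ≤ √(∑ i, w i ^ 2) := (pi_norm_le_iff_of_nonneg (Real.sqrt_nonneg _)).2 fun i =>
    Real.le_sqrt_of_sq_le (by
      rw [Real.norm_eq_abs, sq_abs]
      exact Finset.single_le_sum (f := fun i => w i ^ 2) (fun i _ => sq_nonneg _)
        (Finset.mem_univ i))
  calc ‖w‖ ^ 2 ≤ √(∑ i, w i ^ 2) ^ 2 := by gcongr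
    _ = _ := Real.sq_sqrt h0

theorem norm_mulVec_le_of_entries {n k : ℕ} {A : Matrix (Fin n) (Fin k) ℝ} {c : ℝ} (hc : 0 ≤ c)
    (hA : ∀ i j, |A i j| ≤ c) (w : Vec k) : ‖A *ᵥ w‖ ≤ k * c * ‖w‖ := by
  refine (pi_norm_le_iff_of_nonneg (by positivity)).2 fun i => ?_
  calc ‖(A *ᵥ w) i‖ ≤ ∑ j, ‖A i j * w j‖ := norm_sum_le Finset.univ fun j => A i j * w j
    _ ≤ ∑ _j : Fin k, c * ‖w‖ := by
        refine Finset.sum_le_sum fun j _ => ?_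
        rw [norm_mul]
        exact mul_le_mul (hA i j) (norm_le_pi_norm w j) (norm_nonneg _) hc
    _ = k * c * ‖w‖ := by simp; ring

theorem isProbabilityMeasure_of_map_fst {k n : ℕ} {ρ : Measure (Vec k × Vec n)}
    (h : ρ.map Prod.fst = stdGaussianLaw k) : IsProbabilityMeasure ρ := by
  have : IsProbabilityMeasure (stdGaussianLaw k) := by unfold stdGaussianLaw; infer_instance
  refine ⟨?_⟩
  have := measure_univ (μ := stdGaussianLaw k)
  rwa [← h, Measure.map_apply measurable_fst MeasurableSet.univ, Set.preimage_univ] at this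

/-- If the law of the nodes visited by `F₁ + B₁ w + θ₁ ξ` with bounded `ξ` is perturbed slightly,
then it is the law of the nodes visited by `F₂ + B₂ w + θ₂ ξ` for another noise `ξ` with
`E|ξ| ≤ 1`. -/
theorem exists_integrableNoise_of_near {n k : ℕ} {Q : Type*} [Fintype Q] [DecidableEq Q]
    [MeasurableSpace Q] [MeasurableSingletonClass Q] {c : Vec n → Q} (hc : Measurable c)
    {r : Q → Vec n} (hr : ∀ q, c (r q) = q) {F₁ F₂ : Vec n} {B₁ B₂ : Matrix (Fin n) (Fin k) ℝ}
    {θ₁ θ₂ τ D ε : ℝ} (hθ₁ : 0 ≤ θ₁) (hθ : θ₁ < θ₂) (hτ : 0 ≤ τ) (hD : 0 ≤ D)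
    (hnear : ∀ w, ‖F₁ + B₁ *ᵥ w - (F₂ + B₂ *ᵥ w)‖ ≤ τ * (1 + ‖w‖ ^ 2))
    (hfar : ∀ q w, ‖r q - (F₂ + B₂ *ᵥ w)‖ ≤ D + τ * (1 + ‖w‖ ^ 2))
    (hsmall : τ * ∫ w, (1 + ‖w‖ ^ 2) ∂stdGaussianLaw k + D * ε ≤ θ₂ - θ₁)
    {ρ : Measure (Vec k × Vec n)} (hρ : ρ ∈ boundedNoiseLaws k n) {m : Q → ℝ}
    (hm : m ∈ stdSimplex ℝ Q)
    (hmρ : ∑ q, |(ρ.map fun z => F₁ + B₁ *ᵥ z.1 + θ₁ • z.2).real (c ⁻¹' {q}) - m q| ≤ ε) :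
    ∃ ρ' ∈ integrableNoiseLaws k n,
      ∀ q, (ρ'.map fun z => F₂ + B₂ *ᵥ z.1 + θ₂ • z.2).real (c ⁻¹' {q}) = m q := by
  have := isProbabilityMeasure_of_map_fst hρ.1
  have hθ₂ : 0 < θ₂ := hθ₁.trans_lt hθ
  set Y : Vec k × Vec n → Vec n := fun z => F₁ + B₁ *ᵥ z.1 + θ₁ • z.2 with hY
  have hYm : Measurable Y := by
    have : Continuous Y := by fun_prop
    exact this.measurable
  obtain ⟨π, hπ, hπm, hπb⟩ := exists_coupling_of_nodes ρ (hc.comp hYm) hm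
  have hbad : MeasurableSet {z : (Vec k × Vec n) × Q | (c ∘ Y) z.1 ≠ z.2} :=
    (measurableSet_eq_fun ((hc.comp hYm).comp measurable_fst) measurable_snd).compl
  set Y' : (Vec k × Vec n) × Q → Vec n := fun z => if (c ∘ Y) z.1 ≠ z.2 then r z.2 else Y z.1
    with hY'
  have hY'm : Measurable Y' := Measurable.ite hbad
    ((measurable_of_finite r).comp measurable_snd) (hYm.comp measurable_fst)
  have hcY' : ∀ z, c (Y' z) = z.2 := fun z => by
    simp only [hY']; split_ifs with h
    · exact hr _
    · simpa using h
  set Z : Vec k → Vec n := fun w => F₂ + B₂ *ᵥ w with hZ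
  have hZm : Measurable Z := by
    have : Continuous Z := by fun_prop
    exact this.measurable
  -- The second component solves `F₂ + B₂ w + θ₂ ξ' = Y'` for `ξ'`; the first is untouched, so `w`
  -- stays Gaussian.
  set H : (Vec k × Vec n) × Q → Vec k × Vec n := fun z => (z.1.1, θ₂⁻¹ • (Y' z - Z z.1.1)) with hH
  have hHm : Measurable H := by
    refine (measurable_fst.comp measurable_fst).prodMk ?_
    exact (hY'm.sub (hZm.comp (measurable_fst.comp measurable_fst))).const_smul θ₂⁻¹
  have hπw : π.map (fun z => z.1.1) = stdGaussianLaw k := by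
    rw [← hρ.1, ← hπ, Measure.map_map measurable_fst measurable_fst]; rfl
  have : IsProbabilityMeasure π := by
    refine ⟨?_⟩
    have := measure_univ (μ := ρ)
    rwa [← hπ, Measure.map_apply measurable_fst MeasurableSet.univ, Set.preimage_univ] at this
  refine ⟨π.map H, ⟨?_, ?_⟩, fun q => ?_⟩
  · rw [Measure.map_map measurable_fst hHm]; exact hπw
  · rw [lintegral_map (by fun_prop) hHm]
    have hξ : ∀ᵐ z ∂π, ‖z.1.2‖ ≤ 1 := by
      have := hρ.2
      rw [← hπ] at this
      exact ae_of_ae_map measurable_fst.aemeasurable this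
    -- The terms stand for the old disturbance, the Gaussian-weighted error and the jump. Only the
    -- constant `D` is charged to the reassignment event; the quadratic term is integrated over the
    -- whole space, so the correlation of this event with `w` does not matter.
    have hbound : ∀ᵐ z ∂π, ‖(H z).2‖ₑ ≤ ENNReal.ofReal (θ₂⁻¹ * θ₁) +
        ENNReal.ofReal (θ₂⁻¹ * τ) * ENNReal.ofReal (1 + ‖z.1.1‖ ^ 2) +
        {z : (Vec k × Vec n) × Q | (c ∘ Y) z.1 ≠ z.2}.indicator
          (fun _ => ENNReal.ofReal (θ₂⁻¹ * D)) z := by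
      filter_upwards [hξ] with z hz
      rw [← ENNReal.ofReal_mul (by positivity), ← ENNReal.ofReal_add (by positivity) (by positivity),
        ← ofReal_norm]
      have hn : ‖(H z).2‖ = θ₂⁻¹ * ‖Y' z - Z z.1.1‖ := by
        rw [hH, norm_smul, Real.norm_of_nonneg (by positivity)]
      rw [hn]
      by_cases hz' : (c ∘ Y) z.1 ≠ z.2
      · rw [Set.indicator_of_mem (show z ∈ {z : (Vec k × Vec n) × Q | (c ∘ Y) z.1 ≠ z.2} from hz'),
          ← ENNReal.ofReal_add (by positivity) (by positivity)]
        refine ENNReal.ofReal_le_ofReal ?_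
        have h1 : Y' z = r z.2 := if_pos hz'
        have h2 := mul_le_mul_of_nonneg_left (hfar z.2 z.1.1) (inv_nonneg.2 hθ₂.le)
        have h3 : 0 ≤ θ₂⁻¹ * θ₁ := by positivity
        rw [h1]; linarith
      · rw [Set.indicator_of_notMem (show z ∉ {z : (Vec k × Vec n) × Q | (c ∘ Y) z.1 ≠ z.2} from hz'),
          add_zero]
        refine ENNReal.ofReal_le_ofReal ?_
        have h1 : Y' z = Y z.1 := if_neg hz'
        have h2 : ‖Y z.1 - Z z.1.1‖ ≤ τ * (1 + ‖z.1.1‖ ^ 2) + θ₁ := by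
          have : Y z.1 - Z z.1.1 =
              (F₁ + B₁ *ᵥ z.1.1 - (F₂ + B₂ *ᵥ z.1.1)) + θ₁ • z.1.2 := by
            simp only [hY, hZ]; abel
          rw [this]
          refine (norm_add_le _ _).trans (add_le_add (hnear _) ?_)
          rw [norm_smul, Real.norm_of_nonneg hθ₁]
          exact mul_le_of_le_one_right hθ₁ hz
        have h3 := mul_le_mul_of_nonneg_left h2 (inv_nonneg.2 hθ₂.le)
        rw [h1]; linarith
    refine (lintegral_mono_ae hbound).trans ?_
    have hG : ∫⁻ z, ENNReal.ofReal (1 + ‖z.1.1‖ ^ 2) ∂π =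
        ENNReal.ofReal (∫ w, (1 + ‖w‖ ^ 2) ∂stdGaussianLaw k) := by
      rw [ofReal_integral_eq_lintegral_ofReal (integrable_one_add_norm_sq_stdGaussianLaw k)
        (ae_of_all _ fun w => by positivity), ← hπw, lintegral_map (by fun_prop) (by fun_prop)]
    have hG0 : 0 ≤ ∫ w, (1 + ‖w‖ ^ 2) ∂stdGaussianLaw k := integral_nonneg fun w => by positivity
    have hmρ' : ∑ q, |ρ.real ((c ∘ Y) ⁻¹' {q}) - m q| ≤ ε := by
      refine le_trans (le_of_eq (Finset.sum_congr rfl fun q _ => ?_)) hmρ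
      rw [map_measureReal_apply hYm (hc (measurableSet_singleton q))]; rfl
    have hε : 0 ≤ ε := (Finset.sum_nonneg fun q _ => abs_nonneg _).trans hmρ'
    rw [lintegral_add_right _ (measurable_const.indicator hbad),
      lintegral_add_right _ (by fun_prop), lintegral_const, lintegral_const_mul _ (by fun_prop), hG,
      lintegral_indicator_const hbad, measure_univ, mul_one]
    refine (add_le_add_right (mul_le_mul_right (hπb.trans (ENNReal.ofReal_le_ofReal hmρ')) _)
      _).trans ?_
    rw [← ENNReal.ofReal_mul (by positivity), ← ENNReal.ofReal_mul (by positivity),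
      ← ENNReal.ofReal_add (by positivity) (by positivity),
      ← ENNReal.ofReal_add (by positivity) (by positivity)]
    refine ENNReal.ofReal_le_one.2 ?_
    have := mul_le_mul_of_nonneg_left hsmall (inv_nonneg.2 hθ₂.le)
    have h1 : θ₂⁻¹ * θ₂ = 1 := inv_mul_cancel₀ hθ₂.ne'
    linarith
  · have hEm : Measurable fun z : Vec k × Vec n => F₂ + B₂ *ᵥ z.1 + θ₂ • z.2 := by
      have : Continuous fun z : Vec k × Vec n => F₂ + B₂ *ᵥ z.1 + θ₂ • z.2 := by fun_prop
      exact this.measurable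
    rw [Measure.map_map hEm hHm]
    have : (fun z : Vec k × Vec n => F₂ + B₂ *ᵥ z.1 + θ₂ • z.2) ∘ H = Y' := by
      funext z
      simp only [hH, hZ, Function.comp_apply, smul_inv_smul₀ hθ₂.ne']
      abel
    rw [this, map_measureReal_apply hY'm (hc (measurableSet_singleton q))]
    have : Y' ⁻¹' (c ⁻¹' {q}) = Prod.snd ⁻¹' {q} := by
      ext z; simp [hcY']
    rw [this, Measure.real, hπm, ENNReal.toReal_ofReal (hm.1 q)]

/-! ### Rectangles, grid cells and the node map -/

theorem IsRectangle.measurableSet {n : ℕ} {C : Set (Vec n)} (h : IsRectangle C) :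
    MeasurableSet C := by
  obtain ⟨J, hJ, rfl⟩ := h
  have : {x : Vec n | ∀ d, x d ∈ J d} = ⋂ d, (fun x : Vec n => x d) ⁻¹' J d := by ext; simp
  rw [this]
  exact MeasurableSet.iInter fun d => measurable_pi_apply d (hJ d).measurableSet

theorem IsRectangle.inter_gridCell {n : ℕ} {C : Set (Vec n)} (h : IsRectangle C) {η : ℝ}
    (hη : 0 < η) (z : Fin n → ℤ) : IsRectangle (C ∩ gridCell η z) := by
  obtain ⟨J, hJ, rfl⟩ := h
  refine ⟨fun d => J d ∩ {t | ⌊t / η⌋ = z d}, fun d => (hJ d).inter ?_, ?_⟩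
  · have hmono : Monotone fun t : ℝ => ⌊t / η⌋ := fun s t hst => Int.floor_mono (by gcongr)
    exact (Set.ordConnected_singleton (a := z d)).preimage_mono hmono
  · ext x
    simp only [gridCell, Set.mem_inter_iff, Set.mem_ofPred_eq, forall_and]

theorem dist_lt_of_mem_gridCell {n : ℕ} {η : ℝ} (hη : 0 < η) {z : Fin n → ℤ} {x y : Vec n}
    (hx : x ∈ gridCell η z) (hy : y ∈ gridCell η z) : dist x y < η := by
  refine (dist_pi_lt_iff hη).2 fun d => ?_
  have h := Int.abs_sub_lt_one_of_floor_eq_floor ((hx d).trans (hy d).symm)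
  rwa [← sub_div, abs_div, abs_of_pos hη, div_lt_one hη] at h

/-- The grid of mesh `η` cuts a finite rectangular partition of a bounded set into finitely many
cells. -/
theorem exists_uniformRefinement {n J : ℕ} {W : Set (Vec n)} (hW : Bornology.IsBounded W)
    {P : Fin J → Set (Vec n)} (hP : IsRectPartition W P) {η : ℝ} (hη : 0 < η) :
    ∃ (N : ℕ) (C : Fin N → Set (Vec n)), IsRectPartition W C ∧ IsUniformRefinement P η C := by
  obtain ⟨hP1, hP2, hP3⟩ := hP
  -- Empty intersections are discarded, since cells must be nonempty.
  set S : Set (Fin J × (Fin n → ℤ)) := {s | (P s.1 ∩ gridCell η s.2).Nonempty} with hS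
  have hfin : S.Finite := by
    obtain ⟨r, hr⟩ := hW.exists_norm_le
    refine (Set.finite_univ.prod (Set.Finite.pi' fun _ : Fin n =>
      Set.finite_Icc ⌊-r / η⌋ ⌊r / η⌋)).subset ?_
    rintro ⟨i, z⟩ ⟨x, hx, hxz⟩
    refine ⟨Set.mem_univ _, fun d => ?_⟩
    have hxW : x ∈ W := hP3 ▸ Set.mem_iUnion_of_mem i hx
    have := abs_le.1 ((norm_le_pi_norm x d).trans (hr x hxW))
    change z d ∈ _
    have hd : ⌊x d / η⌋ = z d := hxz d
    rw [← hd]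
    exact ⟨Int.floor_mono (by gcongr; exact this.1), Int.floor_mono (by gcongr; exact this.2)⟩
  have := hfin.fintype
  let e := (Fintype.equivFin S).symm
  refine ⟨Fintype.card S, fun j => P (e j).1.1 ∩ gridCell η (e j).1.2, ⟨fun j =>
    ⟨(hP1 _).1.inter_gridCell hη _, (e j).2⟩, fun i j hij => ?_, ?_⟩, fun j => ⟨_, _, rfl⟩⟩
  · refine Set.disjoint_left.2 ?_
    rintro x ⟨hx, hxz⟩ ⟨hy, hyz⟩
    refine hij (e.injective (Subtype.ext (Prod.ext ?_ ?_)))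
    · by_contra h
      exact Set.disjoint_left.1 (hP2 h) hx hy
    · funext d; rw [← hxz d, ← hyz d]
  · ext x
    simp only [Set.mem_iUnion]
    constructor
    · rintro ⟨j, hx, -⟩; exact hP3 ▸ Set.mem_iUnion_of_mem _ hx
    · intro hx
      rw [← hP3] at hx
      obtain ⟨i, hi⟩ := Set.mem_iUnion.1 hx
      have hxz : x ∈ gridCell η fun d => ⌊x d / η⌋ := fun d => rfl
      refine ⟨e.symm ⟨(i, fun d => ⌊x d / η⌋), ⟨x, hi, hxz⟩⟩, ?_⟩
      rw [e.apply_symm_apply]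
      exact ⟨hi, hxz⟩

/-- The state-level relation of a rectangular partition is the graph of a measurable map. -/
theorem exists_measurable_partitionRel_eq {n N : ℕ} {W : Set (Vec n)} (hW : MeasurableSet W)
    {C : Fin N → Set (Vec n)} (hC : IsRectPartition W C) :
    ∃ c : Vec n → Fin (N + 1), Measurable c ∧ partitionRel W C = {s | c s.1 = s.2} ∧
      (∀ j, c ⁻¹' {Fin.castSucc j} = C j) ∧ c ⁻¹' {Fin.last N} = Wᶜ := by
  classical
  obtain ⟨hC1, hC2, hC3⟩ := hC
  have hex : ∀ x, ∃ q, (x, q) ∈ partitionRel W C := fun x => by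
    by_cases hx : x ∈ W
    · rw [← hC3] at hx
      obtain ⟨j, hj⟩ := Set.mem_iUnion.1 hx
      exact ⟨j.castSucc, Or.inl ⟨j, rfl, hj⟩⟩
    · exact ⟨Fin.last N, Or.inr ⟨rfl, hx⟩⟩
  have hsub : ∀ j, C j ⊆ W := fun j => hC3 ▸ Set.subset_iUnion C j
  have huniq : ∀ x q q', (x, q) ∈ partitionRel W C → (x, q') ∈ partitionRel W C → q = q' := by
    rintro x q q' (⟨j, rfl, hj⟩ | ⟨rfl, hj⟩) (⟨j', rfl, hj'⟩ | ⟨rfl, hj'⟩)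
    · by_contra h
      exact Set.disjoint_left.1 (hC2 fun h' => h (congrArg _ h')) hj hj'
    · exact absurd (hsub j hj) hj'
    · exact absurd (hsub j' hj') hj
    · rfl
  choose c hc using hex
  have hrel : ∀ x q, c x = q ↔ (x, q) ∈ partitionRel W C := fun x q =>
    ⟨fun h => h ▸ hc x, fun h => huniq x _ _ (hc x) h⟩
  have h1 : ∀ j, c ⁻¹' {Fin.castSucc j} = C j := fun j => by
    ext x
    rw [Set.mem_preimage, Set.mem_singleton_iff, hrel]
    constructor
    · rintro (⟨j', h, hj'⟩ | ⟨h, -⟩)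
      · rwa [Fin.castSucc_injective N h]
      · exact absurd h (Fin.castSucc_lt_last j).ne
    · exact fun h => Or.inl ⟨j, rfl, h⟩
  have h2 : c ⁻¹' {Fin.last N} = Wᶜ := by
    ext x
    rw [Set.mem_preimage, Set.mem_singleton_iff, hrel]
    constructor
    · rintro (⟨j', h, -⟩ | ⟨-, h⟩)
      · exact absurd h.symm (Fin.castSucc_lt_last j').ne
      · exact h
    · exact fun h => Or.inr ⟨rfl, h⟩
  refine ⟨c, measurable_to_countable' fun q => ?_, ?_, h1, h2⟩
  · refine Fin.lastCases ?_ (fun j => ?_) q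
    · rw [h2]; exact hW.compl
    · rw [h1]; exact (hC1 j).1.measurableSet
  · ext ⟨x, q⟩; exact (hrel x q).symm

/-! ### Finite systems from nets of transition rows -/

/-- Finitely many boxes around points of the sets `S a i` give a finite-state system whose
transition rows cover the sets `S a i` and stay close to them. -/
theorem exists_finiteMarkovSystem_near {Q AP : Type*} [Fintype Q] [DecidableEq Q] {M : ℕ}
    (label : Q → Set AP) {S : Fin M → Q → Set (Q → ℝ)} (hS : ∀ a i, S a i ⊆ stdSimplex ℝ Q)
    (hne : ∀ a i, (S a i).Nonempty) {δ : Q → ℝ} (hδ : ∀ i, 0 ≤ δ i)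
    (hnet : ∀ a i, 0 < δ i ∨ (S a i).Finite) :
    ∃ I : FiniteMarkovSystem Q (Fin M) AP, I.label = label ∧ I.IsGeneratedByBMDPs ∧
      (∀ a i, ∀ s ∈ S a i, ∃ m ∈ I.trans a, m.1 i = s) ∧
      ∀ a, ∀ m ∈ I.trans a, ∀ i, ∃ s ∈ S a i, ∀ j, |s j - m.1 i j| ≤ δ i := by
  have hF : ∀ a i, ∃ F ⊆ S a i, F.Finite ∧ ∀ s ∈ S a i, ∃ t ∈ F, ∀ j, |t j - s j| ≤ δ i := by
    intro a i
    rcases hnet a i with h | h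
    · have htb : TotallyBounded (S a i) :=
        (isCompact_stdSimplex ℝ Q).totallyBounded.subset (hS a i)
      obtain ⟨F, hFS, hF, hcov⟩ := Metric.finite_approx_of_totallyBounded htb (δ i) h
      refine ⟨F, hFS, hF, fun s hs => ?_⟩
      obtain ⟨t, ht, hst⟩ := Set.mem_iUnion₂.1 (hcov hs)
      refine ⟨t, ht, fun j => ?_⟩
      rw [← Real.dist_eq, dist_comm]
      exact (dist_le_pi_dist s t j).trans (Metric.mem_ball.1 hst).le
    · exact ⟨S a i, subset_rfl, h, fun s hs => ⟨s, hs, fun j => by simpa using hδ i⟩⟩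
  choose F hFS hFfin hFnet using hF
  have : ∀ a i, Fintype (F a i) := fun a i => (hFfin a i).fintype
  -- One BMDP per simultaneous choice of a net point for every action and row.
  let Λ := ∀ a i, F a i
  have hFne : ∀ a i, Nonempty (F a i) := fun a i => by
    obtain ⟨s, hs⟩ := hne a i
    obtain ⟨t, ht, -⟩ := hFnet a i s hs
    exact ⟨⟨t, ht⟩⟩
  let B : Λ → BMDP Q (Fin M) AP := fun g =>
    ⟨fun a i j => (g a i).1 j - δ i, fun a i j => (g a i).1 j + δ i, label⟩
  refine ⟨⟨fun a => ⋃ g, (B g).trans a, label⟩, rfl, ⟨Fintype.card Λ, fun l =>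
    B ((Fintype.equivFin Λ).symm l), fun l => rfl, fun a => ?_⟩, fun a i s hs => ?_,
    fun a m hm i => ?_⟩
  · exact ((Fintype.equivFin Λ).symm.surjective.iUnion_comp fun g => (B g).trans a).symm
  · obtain ⟨t, ht, hts⟩ := hFnet a i s hs
    -- Only row `i` under action `a` has to match `s`; every other row of `m` is the centre of its
    -- own box.
    let g : Λ := fun a' i' => if h : a' = a ∧ i' = i then ⟨t, h.1 ▸ h.2 ▸ ht⟩
      else Classical.choice (hFne a' i')
    have hgi : (g a i).1 = t := by simp [g]
    let m : Matrix Q Q ℝ := fun i' => if i' = i then s else (g a i').1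
    have hrow : ∀ i', m i' ∈ stdSimplex ℝ Q := fun i' => by
      simp only [m]; split_ifs
      · exact hS a i hs
      · exact hS a i' (hFS a i' (g a i').2)
    refine ⟨⟨m, ?_⟩, Set.mem_iUnion.2 ⟨g, fun i' j => ?_⟩, by simp [m]⟩
    · rw [Matrix.mem_rowStochastic_iff_sum]
      exact ⟨fun i' j => (hrow i').1 j, fun i' => (hrow i').2⟩
    · change (g a i').1 j - δ i' ≤ m i' j ∧ m i' j ≤ (g a i').1 j + δ i'
      by_cases h : i' = i
      · subst h
        rw [hgi]
        have := abs_le.1 (hts j)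
        simp only [m, if_true]
        constructor <;> linarith
      · simp only [m, if_neg h]
        constructor <;> linarith [hδ i']
  · obtain ⟨g, hg⟩ := Set.mem_iUnion.1 hm
    refine ⟨(g a i).1, hFS a i (g a i).2, fun j => abs_le.2 ?_⟩
    have : (g a i).1 j - δ i ≤ m.1 i j ∧ m.1 i j ≤ (g a i).1 j + δ i := hg i j
    constructor <;> linarith

theorem StochasticMatrix.rowLaw_real_singleton {Q : Type*} [Fintype Q] [DecidableEq Q]
    [MeasurableSpace Q] [MeasurableSingletonClass Q] (M : StochasticMatrix Q) (i j : Q) :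
    (M.rowLaw i : Measure Q).real {j} = M.1 i j := by
  have h : (M.rowLaw i : Measure Q) {j} = ENNReal.ofReal (M.1 i j) := by
    change (∑ l, ENNReal.ofReal (M.1 i l) • Measure.dirac l) {j} = _
    rw [Measure.coe_finsetSum, Finset.sum_apply, Finset.sum_eq_single j]
    · simp
    · intro l _ hl
      simp [hl]
    · simp
  rw [Measure.real, h, ENNReal.toReal_ofReal (M.2.1 i j)]

/-! ### Transition kernels and boundary modifications -/

theorem exists_mem_perturbedTrans {n p k : ℕ} {f : Vec n → Vec p → Vec n}
    {b : Vec n → Matrix (Fin n) (Fin k) ℝ} {u : Vec p} (hf : Continuous fun x => f x u)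
    (hb : Continuous b) (θ : ℝ) {noise : Set (Measure (Vec k × Vec n))}
    {ρ : Measure (Vec k × Vec n)} [IsProbabilityMeasure ρ] (hρ : ρ ∈ noise) :
    ∃ T ∈ perturbedTrans f b θ noise u,
      ∀ x, T.1 x = ρ.map fun z => f x u + b x *ᵥ z.1 + θ • z.2 := by
  set g : Vec n × Vec k × Vec n → Vec n := fun y => f y.1 u + b y.1 *ᵥ y.2.1 + θ • y.2.2 with hg
  have hgm : Measurable g := by
    have : Continuous g := by fun_prop
    exact this.measurable
  let κ : Kernel (Vec n) (Vec n) := ⟨fun x => (ρ.map (Prod.mk x)).map g,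
    (Measure.measurable_map g hgm).comp Measurable.map_prodMk_left⟩
  have hκ : ∀ x, κ x = ρ.map fun z => f x u + b x *ᵥ z.1 + θ • z.2 := fun x =>
    Measure.map_map hgm measurable_prodMk_left
  have hκp : IsMarkovKernel κ := ⟨fun x => by
    rw [hκ]
    exact Measure.isProbabilityMeasure_map (hgm.comp measurable_prodMk_left).aemeasurable⟩
  exact ⟨⟨κ, hκp⟩, ⟨ρ, hρ, hκ⟩, hκ⟩

/-- Collapse the complement of `W` to one boundary point `p`, and jump to `p` from every state
outside `W`. -/
theorem exists_isBoundaryModification {n : ℕ} (hn : 0 < n) {W : Set (Vec n)}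
    (hW : Bornology.IsBounded W) (hWo : IsOpen W) (T : MarkovKernel (Vec n)) :
    ∃ T', IsBoundaryModification W T T' := by
  classical
  have : Nonempty (Fin n) := ⟨⟨0, hn⟩⟩
  have hWne : W ≠ Set.univ := fun h => NormedSpace.unbounded_univ ℝ (Vec n) (h ▸ hW)
  have hdis : Disjoint W (frontier W) := by
    rw [hWo.frontier_eq]; exact Set.disjoint_sdiff_right
  -- A nonempty bounded `W` has a boundary point because `n > 0`. For empty `W` the frontier is
  -- empty and any `p` will do.
  obtain ⟨p, hpW, hp⟩ : ∃ p, p ∉ W ∧ (W.Nonempty → p ∈ frontier W) := by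
    by_cases h : W.Nonempty
    · obtain ⟨p, hp⟩ := nonempty_frontier_iff.2 ⟨h, hWne⟩
      exact ⟨p, Set.disjoint_right.1 hdis hp, fun _ => hp⟩
    · obtain ⟨p, hp⟩ := (Set.ne_univ_iff_exists_notMem W).1 hWne
      exact ⟨p, hp, fun h' => absurd h' h⟩
  have hφ : Measurable (W.piecewise id fun _ => p) :=
    Measurable.piecewise hWo.measurableSet measurable_id measurable_const
  have := T.2
  have := Kernel.IsMarkovKernel.map T.1 hφ
  let T' : Kernel (Vec n) (Vec n) := Kernel.piecewise hWo.measurableSet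
    (T.1.map (W.piecewise id fun _ => p)) (Kernel.const _ (Measure.dirac p))
  have hT'W : ∀ x ∈ W, ∀ s, MeasurableSet s →
      T' x s = T.1 x ((W.piecewise id fun _ => p) ⁻¹' s) := fun x hx s hs => by
    rw [Kernel.piecewise_apply, if_pos hx, Kernel.map_apply' _ hφ _ hs]
  have hT'c : ∀ x ∉ W, T' x = Measure.dirac p := fun x hx => by
    rw [Kernel.piecewise_apply, if_neg hx, Kernel.const_apply]
  refine ⟨⟨T', inferInstanceAs (IsMarkovKernel (Kernel.piecewise _ _ _))⟩,
    fun x hx => ⟨fun Γ hΓ hΓW => ?_, ?_⟩, fun x hx => ?_, fun x hx => ?_⟩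
  · change T' x Γ = _
    rw [hT'W x hx Γ hΓ]
    congr 1
    ext y
    by_cases hy : y ∈ W
    · simp [hy]
    · have h1 : p ∉ Γ := fun h => hpW (hΓW h)
      have h2 : y ∉ Γ := fun h => hy (hΓW h)
      simp [hy, h1, h2]
  · change T' x _ = _
    rw [hT'W x hx _ isClosed_frontier.measurableSet]
    congr 1
    ext y
    by_cases hy : y ∈ W
    · simp [hy, Set.disjoint_left.1 hdis hy]
    · simp [hy, hp ⟨x, hx⟩]
  · change T' x _ = _
    have hne : W.Nonempty := by
      by_contra h
      rw [Set.not_nonempty_iff_eq_empty] at h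
      simp [h] at hx
    rw [hT'c x (Set.disjoint_right.1 hdis hx),
      Measure.dirac_apply' _ isClosed_frontier.measurableSet, Set.indicator_of_mem (hp hne)]
    rfl
  · change T' x _ = _
    rw [hT'c x hx, Measure.dirac_apply' _ hWo.measurableSet, Set.indicator_of_notMem hpW]

section Nodes

variable {n N : ℕ} {W : Set (Vec n)} {T T' : MarkovKernel (Vec n)} {c : Vec n → Fin (N + 1)}

/-- From inside `W` the modification is invisible to the nodes: every node but the last has its
preimage inside `W`, and the last one follows by complement. -/
theorem IsBoundaryModification.real_preimage_of_mem (h : IsBoundaryModification W T T')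
    (hW : MeasurableSet W) (hc : Measurable c) (hcW : c ⁻¹' {Fin.last N} = Wᶜ) {x : Vec n}
    (hx : x ∈ W) (q : Fin (N + 1)) :
    (T'.1 x).real (c ⁻¹' {q}) = (T.1 x).real (c ⁻¹' {q}) := by
  have := T.2
  have := T'.2
  have hsub : ∀ s, MeasurableSet s → s ⊆ W → (T'.1 x).real s = (T.1 x).real s := fun s hs hsW => by
    rw [Measure.real, Measure.real, (h.1 x hx).1 s hs hsW]
  by_cases hq : q = Fin.last N
  · rw [hq, hcW, probReal_compl_eq_one_sub hW, probReal_compl_eq_one_sub hW, hsub W hW subset_rfl]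
  · refine hsub _ (hc (measurableSet_singleton q)) fun y hy => ?_
    by_contra hyW
    rw [← Set.mem_compl_iff, ← hcW] at hyW
    exact hq ((Set.mem_singleton_iff.1 hy).symm.trans hyW)

theorem IsBoundaryModification.real_preimage_of_notMem (h : IsBoundaryModification W T T')
    (hW : MeasurableSet W) (hcW : c ⁻¹' {Fin.last N} = Wᶜ) {x : Vec n}
    (hx : x ∉ W) (q : Fin (N + 1)) :
    (T'.1 x).real (c ⁻¹' {q}) = Pi.single (M := fun _ => ℝ) (Fin.last N) 1 q := by
  have := T'.2
  have h0 : (T'.1 x).real W = 0 := by rw [Measure.real, h.2.2 x hx, ENNReal.toReal_zero]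
  by_cases hq : q = Fin.last N
  · rw [hq, hcW, probReal_compl_eq_one_sub hW, h0, Pi.single_eq_same, sub_zero]
  · rw [Pi.single_eq_of_ne hq]
    refine le_antisymm (h0 ▸ measureReal_mono fun y hy => ?_) measureReal_nonneg
    by_contra hyW
    rw [← Set.mem_compl_iff, ← hcW] at hyW
    exact hq ((Set.mem_singleton_iff.1 hy).symm.trans hyW)

theorem MarkovKernel.real_preimage_mem_stdSimplex (T : MarkovKernel (Vec n)) (hc : Measurable c)
    (x : Vec n) : (fun q => (T.1 x).real (c ⁻¹' {q})) ∈ stdSimplex ℝ (Fin (N + 1)) := by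
  have := T.2
  refine ⟨fun q => measureReal_nonneg, ?_⟩
  rw [← measureReal_iUnion_fintype (fun i j hij => Disjoint.preimage _ (by simpa using hij))
    fun q => hc (measurableSet_singleton q)]
  have : ⋃ q, c ⁻¹' {q} = Set.univ := by ext z; simp
  rw [this, probReal_univ]

end Nodes

/-- The zero disturbance shows that the collections of transition probabilities are nonempty. -/
theorem prod_dirac_zero_mem_boundedNoiseLaws (k n : ℕ) :
    (stdGaussianLaw k).prod (Measure.dirac (0 : Vec n)) ∈ boundedNoiseLaws k n := by
  have : IsProbabilityMeasure (stdGaussianLaw k) := by unfold stdGaussianLaw; infer_instance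
  refine ⟨by simp [Measure.map_fst_prod], ?_⟩
  have h : ((stdGaussianLaw k).prod (Measure.dirac (0 : Vec n))).map Prod.snd =
      Measure.dirac 0 := by simp [Measure.map_snd_prod]
  have h' : ∀ᵐ y ∂Measure.dirac (0 : Vec n), ‖y‖ ≤ 1 := by
    rw [ae_dirac_iff (measurableSet_le measurable_norm measurable_const)]; simp
  rw [← h] at h'
  exact ae_of_ae_map measurable_snd.aemeasurable h'

theorem boundedNoiseLaws_subset_integrableNoiseLaws (k n : ℕ) :
    boundedNoiseLaws k n ⊆ integrableNoiseLaws k n := fun ρ hρ => by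
  have := isProbabilityMeasure_of_map_fst hρ.1
  refine ⟨hρ.1, (lintegral_mono_ae (hρ.2.mono fun z hz => ?_)).trans
    (by simp : ∫⁻ _, 1 ∂ρ ≤ 1)⟩
  rw [← ofReal_norm]
  exact ENNReal.ofReal_le_one.2 hz

/-! ### Choice of the constants and the two abstractions -/

theorem mainTheorem2 {n p k J : ℕ} (hn : 0 < n) {AP : Type*} [Finite AP]
    (W : Set (Vec n)) (hW : Bornology.IsBounded W) (hWo : IsOpen W)
    (U : Set (Vec p)) (hU : IsCompact U)
    (f : Vec n → Vec p → Vec n) (hf : LocallyLipschitz fun z : Vec n × Vec p => f z.1 z.2)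
    (b : Vec n → Matrix (Fin n) (Fin k) ℝ) (hb : ∀ i j, LocallyLipschitz fun x => b x i j)
    (L : Vec n → Set AP) (hL : ∀ A : Set AP, MeasurableSet (L ⁻¹' {A}))
    (P : Fin J → Set (Vec n)) (hP : IsRectPartition W P) (hLP : LabelConstantOn L W P)
    (θ₁ θ₂ : ℝ) (hθ₁ : 0 ≤ θ₁) (hθ : θ₁ < θ₂) :
    ∃ (η : ℝ) (N M : ℕ) (C : Fin N → Set (Vec n))
      (R : SetRel (ProbabilityMeasure (Vec n)) (ProbabilityMeasure (Fin (N + 1))))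
      (I : FiniteMarkovSystem (Fin (N + 1)) (Fin M) AP),
      0 < η ∧ IsRectPartition W C ∧ IsUniformRefinement P η C ∧ I.IsGeneratedByBMDPs ∧
      Abstracts (modifiedSystem W U f b θ₁ (boundedNoiseLaws k n) L hL) I
        (partitionRel W C) R ∧
      ConverseAbstracts I (modifiedSystem W U f b θ₂ (integrableNoiseLaws k n) L hL)
        (partitionRel W C).inv R.inv := by
  have : Nonempty (Fin n) := ⟨⟨0, hn⟩⟩
  have : IsProbabilityMeasure (stdGaussianLaw k) := by unfold stdGaussianLaw; infer_instance
  have hfc : Continuous fun z : Vec n × Vec p => f z.1 z.2 := hf.continuous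
  have hfu : ∀ u, Continuous fun x => f x u := fun u => hfc.comp (by fun_prop : Continuous
    fun x : Vec n => (x, u))
  have hbc : Continuous b := continuous_pi fun i => continuous_pi fun j => (hb i j).continuous
  have hWm : MeasurableSet W := hWo.measurableSet
  obtain ⟨x₀, hx₀⟩ : ∃ x, x ∉ W := (Set.ne_univ_iff_exists_notMem W).1 fun h =>
    NormedSpace.unbounded_univ ℝ (Vec n) (h ▸ hW)
  set G := ∫ w, (1 + ‖w‖ ^ 2) ∂stdGaussianLaw k with hG
  have hG0 : 0 ≤ G := integral_nonneg fun w => by positivity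
  have hgap : 0 < θ₂ - θ₁ := sub_pos.2 hθ
  -- Half of the gap covers `τ * G`. In `κ` below, the divisor `1 + k` accounts for `f` and for the
  -- `k` terms in each entry of `b x *ᵥ w`.
  set τ := (θ₂ - θ₁) / (2 * (G + 1)) with hτ
  have hτ0 : 0 < τ := by positivity
  set κ := τ / (1 + k) with hκ
  have hκ0 : 0 < κ := by positivity
  -- uniform continuity and boundedness of the coefficients
  set Φ : Vec n × Vec p → Vec n × (Fin n → Fin k → ℝ) :=
    fun z => (f z.1 z.2, fun i j => b z.1 i j) with hΦ
  have hΦc : Continuous Φ := hfc.prodMk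
    (continuous_pi fun i => continuous_pi fun j => (hb i j).continuous.comp continuous_fst)
  have hK : IsCompact (closure W ×ˢ U) := hW.isCompact_closure.prod hU
  obtain ⟨A, hA⟩ : ∃ A, ∀ z ∈ closure W ×ˢ U, ‖Φ z‖ ≤ A :=
    hK.exists_bound_of_continuousOn hΦc.continuousOn
  -- The modulus of uniform continuity serves both as mesh size of the grid and as radius of the
  -- input net.
  obtain ⟨η, hη, hunif⟩ := Metric.uniformContinuousOn_iff.1
    (hK.uniformContinuousOn_of_continuous hΦc.continuousOn) κ hκ0
  have hentry : ∀ (B : Fin n → Fin k → ℝ) i j, |B i j| ≤ ‖B‖ := fun B i j =>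
    (norm_le_pi_norm (B i) j).trans (norm_le_pi_norm B i)
  have hnear : ∀ x ∈ W, ∀ x' ∈ W, ∀ u ∈ U, ∀ u' ∈ U, dist x x' < η → dist u u' < η → ∀ w,
      ‖f x u + b x *ᵥ w - (f x' u' + b x' *ᵥ w)‖ ≤ τ * (1 + ‖w‖ ^ 2) := by
    intro x hx x' hx' u hu u' hu' hxx huu w
    have h := hunif (x, u) ⟨subset_closure hx, hu⟩ (x', u') ⟨subset_closure hx', hu'⟩
      (by rw [Prod.dist_eq]; exact max_lt hxx huu)
    rw [dist_eq_norm] at h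
    have h1 : ‖f x u - f x' u'‖ ≤ κ := (norm_fst_le (Φ (x, u) - Φ (x', u'))).trans h.le
    have h2 : ∀ i j, |(b x - b x') i j| ≤ κ := fun i j =>
      (hentry (Φ (x, u) - Φ (x', u')).2 i j).trans ((norm_snd_le _).trans h.le)
    have h3 : f x u + b x *ᵥ w - (f x' u' + b x' *ᵥ w) =
        f x u - f x' u' + (b x - b x') *ᵥ w := by rw [Matrix.sub_mulVec]; abel
    have h4 : ‖w‖ ≤ 1 + ‖w‖ ^ 2 := by nlinarith [sq_nonneg (‖w‖ - 1), norm_nonneg w]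
    calc _ ≤ κ + k * κ * ‖w‖ := by
          rw [h3]
          exact (norm_add_le _ _).trans (add_le_add h1 (norm_mulVec_le_of_entries hκ0.le h2 w))
      _ ≤ κ * (1 + ‖w‖ ^ 2) + k * κ * (1 + ‖w‖ ^ 2) := by
          gcongr
          exact le_mul_of_one_le_right hκ0.le (by nlinarith [sq_nonneg ‖w‖])
      _ = τ * (1 + ‖w‖ ^ 2) := by rw [hκ]; field_simp
  -- the cells and their representatives
  obtain ⟨N, C, hC, hPC⟩ := exists_uniformRefinement hW hP hη
  obtain ⟨c, hcm, hcrel, hcC, hcW⟩ := exists_measurable_partitionRel_eq hWm hC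
  have hpre : ∀ q, (partitionRel W C).preimage {q} = c ⁻¹' {q} := fun q => by
    ext x; simp [hcrel, SetRel.preimage]
  have himg : ∀ q, (partitionRel W C).inv.image {q} = c ⁻¹' {q} := fun q => by
    ext x; simp [hcrel, SetRel.image]
  have hsame : ∀ x y, c x = c y →
      (∃ i z, x ∈ P i ∩ gridCell η z ∧ y ∈ P i ∩ gridCell η z) ∨ x ∉ W ∧ y ∉ W := by
    intro x y hxy
    rcases Fin.eq_castSucc_or_eq_last (c y) with ⟨j, hj⟩ | hj
    · obtain ⟨i, z, hiz⟩ := hPC j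
      have hx : x ∈ C j := hcC j ▸ (hxy.trans hj)
      have hy : y ∈ C j := hcC j ▸ hj
      exact Or.inl ⟨i, z, hiz ▸ hx, hiz ▸ hy⟩
    · have hx : x ∈ Wᶜ := hcW ▸ (hxy.trans hj)
      have hy : y ∈ Wᶜ := hcW ▸ hj
      exact Or.inr ⟨hx, hy⟩
  have hLc : ∀ x y, c x = c y → L x = L y := by
    intro x y hxy
    rcases hsame x y hxy with ⟨i, z, hx, hy⟩ | ⟨hx, hy⟩
    · exact hLP.1 i x hx.1 y hy.1
    · exact hLP.2 x hx y hy
  obtain ⟨r, hr⟩ : ∃ r : Fin (N + 1) → Vec n, ∀ q, c (r q) = q := by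
    suffices h : ∀ q, ∃ x, c x = q from ⟨fun q => (h q).choose, fun q => (h q).choose_spec⟩
    intro q
    rcases Fin.eq_castSucc_or_eq_last q with ⟨j, rfl⟩ | rfl
    · obtain ⟨x, hx⟩ := (hC.1 j).2
      rw [← hcC j] at hx
      exact ⟨x, hx⟩
    · have : x₀ ∈ Wᶜ := hx₀
      rw [← hcW] at this
      exact ⟨x₀, this⟩
  -- the finite set of inputs
  obtain ⟨V, hVU, hVfin, hUV⟩ := hU.finite_cover_balls hη
  have := hVfin.fintype
  let v : Fin (Fintype.card V) → U := fun a =>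
    ⟨((Fintype.equivFin V).symm a).1, hVU ((Fintype.equivFin V).symm a).2⟩
  have hv : ∀ u ∈ U, ∃ a, dist (v a : Vec p) u < η := fun u hu => by
    obtain ⟨u', hu', h⟩ := Set.mem_iUnion₂.1 (hUV hu)
    refine ⟨Fintype.equivFin V ⟨u', hu'⟩, ?_⟩
    simpa [v, dist_comm] using h
  -- the finite-state system
  set D := ‖r‖ + A + (k * A) ^ 2 / (4 * τ) with hD
  -- The errors of the `N + 1` entries sum to at most `(N + 1) * δ`, and `D` times this stays below
  -- the other half of the gap. The absolute value is there because `0 ≤ A` is known only once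
  -- `closure W ×ˢ U` has a point.
  set δ := (θ₂ - θ₁) / (2 * ((|D| + 1) * (N + 1))) with hδ
  have hδ0 : 0 < δ := by positivity
  set sys₁ := modifiedSystem W U f b θ₁ (boundedNoiseLaws k n) L hL with hsys₁
  set sys₂ := modifiedSystem W U f b θ₂ (integrableNoiseLaws k n) L hL with hsys₂
  let S : Fin (Fintype.card V) → Fin (N + 1) → Set (Fin (N + 1) → ℝ) := fun a i =>
    {s | ∃ x, c x = i ∧ ∃ T ∈ sys₁.trans (v a), s = fun q => (T.1 x).real (c ⁻¹' {q})}
  have hlast : ∀ x, c x = Fin.last N ↔ x ∉ W := fun x => by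
    rw [← Set.mem_compl_iff, ← hcW]; rfl
  -- Tolerance 0 at `Δ`: the absorbing row is the only possible one there, and no noise could
  -- realise a perturbation of it.
  obtain ⟨I, hIL, hIB, hI₁, hI₂⟩ := exists_finiteMarkovSystem_near (fun q => L (r q)) (S := S)
    (δ := fun i => if i = Fin.last N then 0 else δ)
    (by rintro a i _ ⟨x, -, T, -, rfl⟩; exact T.real_preimage_mem_stdSimplex hcm x)
    (fun a i => by
      have h0 := prod_dirac_zero_mem_boundedNoiseLaws k n
      obtain ⟨T, hT, -⟩ := exists_mem_perturbedTrans (hfu (v a)) hbc θ₁ h0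
      obtain ⟨T', hT'⟩ := exists_isBoundaryModification hn hW hWo T
      exact ⟨_, r i, hr i, T', ⟨T, hT, hT'⟩, rfl⟩)
    (fun i => by split_ifs <;> positivity)
    (fun a i => by
      by_cases hi : i = Fin.last N
      · refine Or.inr ((Set.finite_singleton
          (Pi.single (M := fun _ => ℝ) (Fin.last N) (1 : ℝ))).subset ?_)
        rintro _ ⟨x, hx, T', ⟨T, -, hT'⟩, rfl⟩
        funext q
        exact hT'.real_preimage_of_notMem hWm hcW ((hlast x).1 (hx.trans hi)) q
      · exact Or.inl (by rwa [if_neg hi]))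
  let R : SetRel (ProbabilityMeasure (Vec n)) (ProbabilityMeasure (Fin (N + 1))) :=
    {s | ∀ q, (s.1 : Measure (Vec n)).real ((partitionRel W C).preimage {q}) =
      (s.2 : Measure (Fin (N + 1))).real {q}}
  refine ⟨η, N, Fintype.card V, C, R, I, hη, hC, hPC, hIB, ⟨fun x => ⟨c x, ?_, ?_⟩,
    fun i a => ⟨v a, fun T hT x hx => ?_⟩⟩, ⟨fun q => ⟨r q, ?_, ?_⟩, fun i u => ?_⟩⟩
  · rw [hcrel]; rfl
  · rw [hIL]; exact hLc _ _ (hr (c x))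
  · rw [hpre] at hx
    obtain ⟨m, hm, hmi⟩ := hI₁ a i _ ⟨x, hx, T, hT, rfl⟩
    refine ⟨m, hm, fun q => ?_, fun j => ?_⟩
    · rw [hpre, m.rowLaw_real_singleton, hmi]; rfl
    · rw [hpre, hmi]
  · change (r q, q) ∈ partitionRel W C
    rw [hcrel]; exact hr q
  · rw [hIL]; rfl
  · obtain ⟨a, ha⟩ := hv u u.2
    refine ⟨a, fun m hm x hx => ?_⟩
    rw [himg] at hx
    have hmi : m.1 i ∈ stdSimplex ℝ (Fin (N + 1)) :=
      ⟨m.2.1 i, Matrix.sum_row_of_mem_rowStochastic m.2 i⟩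
    suffices h : ∃ T ∈ sys₂.trans u, ∀ q, (T.1 x).real (c ⁻¹' {q}) = m.1 i q by
      obtain ⟨T, hT, h⟩ := h
      refine ⟨T, hT, fun q => ?_, fun j => ?_⟩
      · rw [hpre]
        exact (h q).trans (m.rowLaw_real_singleton i q).symm
      · rw [himg, h]
    obtain ⟨_, ⟨y, hy, T₁', ⟨T₁, ⟨ρ, hρ, hT₁⟩, hT₁'⟩, rfl⟩, hclose⟩ := hI₂ a m hm i
    by_cases hi : i = Fin.last N
    · obtain ⟨T, hT, -⟩ := exists_mem_perturbedTrans (hfu u) hbc θ₂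
        (boundedNoiseLaws_subset_integrableNoiseLaws k n (prod_dirac_zero_mem_boundedNoiseLaws k n))
      obtain ⟨T', hT'⟩ := exists_isBoundaryModification hn hW hWo T
      refine ⟨T', ⟨T, hT, hT'⟩, fun q => ?_⟩
      have h : |(T₁'.1 y).real (c ⁻¹' {q}) - m.1 i q| ≤ _ := hclose q
      rw [if_pos hi, hT₁'.real_preimage_of_notMem hWm hcW ((hlast y).1 (hy.trans hi)) q] at h
      rw [hT'.real_preimage_of_notMem hWm hcW ((hlast x).1 (Eq.trans hx hi)) q]
      exact sub_eq_zero.1 (abs_nonpos_iff.1 h)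
    · rcases hsame y x (hy.trans hx.symm) with ⟨l, z, hyl, hxl⟩ | ⟨hyW, -⟩
      swap
      · exact absurd (hy.symm.trans ((hlast y).2 hyW)) hi
      have hPW : P l ⊆ W := hP.2.2 ▸ Set.subset_iUnion P l
      have hyW := hPW hyl.1
      have hxW := hPW hxl.1
      have hΦx := hA (x, u) ⟨subset_closure hxW, u.2⟩
      have hA0 : 0 ≤ A := (norm_nonneg _).trans hΦx
      have hD0 : 0 ≤ D := by positivity
      obtain ⟨ρ', hρ', hρm⟩ := exists_integrableNoise_of_near hcm hr hθ₁ hθ hτ0.le hD0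
        (hnear y hyW x hxW (v a) (v a).2 u u.2 (dist_lt_of_mem_gridCell hη hyl.2 hxl.2) ha)
        (fun q w => by
          have h1 : ‖f x u‖ ≤ A := (norm_fst_le (Φ (x, u))).trans hΦx
          have h2 : ‖b x *ᵥ w‖ ≤ k * A * ‖w‖ := norm_mulVec_le_of_entries hA0
            (fun i j => (hentry (Φ (x, u)).2 i j).trans ((norm_snd_le _).trans hΦx)) w
          -- Young's inequality: the linear growth splits into a constant, absorbed in `D`, and a
          -- quadratic term with the small coefficient `τ`.
          have h3 : k * A * ‖w‖ ≤ (k * A) ^ 2 / (4 * τ) + τ * ‖w‖ ^ 2 := by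
            rw [div_add' _ _ _ (by positivity), le_div_iff₀ (by positivity)]
            nlinarith [sq_nonneg (k * A - 2 * τ * ‖w‖)]
          have h4 : ‖r q - (f x u + b x *ᵥ w)‖ ≤ ‖r‖ + (A + k * A * ‖w‖) :=
            (norm_sub_le _ _).trans (add_le_add (norm_le_pi_norm r q)
              ((norm_add_le _ _).trans (add_le_add h1 h2)))
          linarith)
        (ε := (N + 1) * δ)
        (by
          have h1 : τ * G ≤ (θ₂ - θ₁) / 2 := by
            rw [hτ, div_mul_eq_mul_div, div_le_div_iff₀ (by positivity) (by positivity)]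
            nlinarith
          have h2 : D * ((N + 1) * δ) ≤ (θ₂ - θ₁) / 2 := by
            have : (N + 1) * δ = (θ₂ - θ₁) / (2 * (D + 1)) := by
              rw [hδ, abs_of_nonneg hD0]; field_simp
            rw [this, mul_div_assoc', div_le_div_iff₀ (by positivity) (by positivity)]
            nlinarith
          linarith)
        hρ hmi
        (by
          calc _ ≤ ∑ _q : Fin (N + 1), δ := by
                refine Finset.sum_le_sum fun q _ => ?_
                have h : |(T₁'.1 y).real (c ⁻¹' {q}) - m.1 i q| ≤ _ := hclose q
                rwa [if_neg hi, hT₁'.real_preimage_of_mem hWm hcm hcW hyW, hT₁] at h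
            _ = (N + 1) * δ := by simp)
      have := isProbabilityMeasure_of_map_fst hρ'.1
      obtain ⟨T, hT, hTx⟩ := exists_mem_perturbedTrans (hfu u) hbc θ₂ hρ'
      obtain ⟨T', hT'⟩ := exists_isBoundaryModification hn hW hWo T
      refine ⟨T', ⟨T, hT, hT'⟩, fun q => ?_⟩
      rw [hT'.real_preimage_of_mem hWm hcm hcW hxW, hTx, hρm]
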